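/- Let $I$ be a (possibly empty) lower semilattice, i.e. a partially ordered set in which any two elements have an infimum, and let $\mathbb{M}=((M_i)_{i\in I},(p_{ij}\colon M_j\to M_i)_{i\le j})$ be a projective system of commutative (additively written) monoids over $I$. Suppose that $\mathbb{M}$ is openly immersive, i.e. that $\operatorname{Spec}(\mathbb{Z}[p_{ij}])\colon\operatorname{Spec}(\mathbb{Z}[M_i])\to\operatorname{Spec}(\mathbb{Z}[M_j])$ is an open immersion for all $i\le j$, and that these affine schemes can be glued, i.e. that the inductive system $(\operatorname{Spec}(\mathbb{Z}[M_i]))_{i\in I}$ has an inductive limit $X_{\mathbb{M}}(\mathbb{Z})$ in the category of schemes for which all the canonical morphisms $\operatorname{Spec}(\mathbb{Z}[M_i])\to X_{\mathbb{M}}(\mathbb{Z})$ are open immersions. (For an openly immersive system this holds, for example, if $\operatorname{Spec}(\mathbb{Z}[M_i])\cap\operatorname{Spec}(\mathbb{Z}[M_j])=\operatorname{Spec}(\mathbb{Z}[M_{\inf(i,j)}])$ inside $\operatorname{Spec}(\mathbb{Z}[M_k])$ whenever $i,j\le k$.) For a scheme $S$ put $X_{\mathbb{M}}(S)=X_{\mathbb{M}}(\mathbb{Z})\times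 S$. A commutative monoid $M$ is called cancellable if $m+k=m+l$ implies $k=l$ for $k,l,m\in M$; torsionfree if $rm=rn$ implies $m=n$ for $m,n\in M$ and every integer $r\ge 1$; of finite type if it is generated by a finite subset; and integrally closed if it is cancellable and, for every $m$ in its group of differences and every integer $r\ge 1$, $rm\in M$ implies $m\in M$. The system $\mathbb{M}$ is said to have one of these properties if every $M_i$ has it. The empty space counts as connected, but not as irreducible; an integral scheme is nonempty; a scheme is normal if all its stalks are integrally closed integral domains. Let $S$ be a scheme. a) If $X_{\mathbb{M}}(S)$ is connected, then $S$ is connected or $I=\emptyset$. Conversely, suppose that $\mathbb{M}$ is torsionfree and cancellable, and that moreover $I$ is finite, or $\mathbb{M}$ is of finite type, or $S$ is affine and $I$ has a smallest element. If $S$ is connected or $I=\emptyset$, then $X_{\mathbb{M}}(S)$ is connected. b) If $X_{\mathbb{M}}(S)$ is irreducible, then $S$ is irreducible and $I\neq\emptyset$; if $\mathbb{M}$ is torsionfree and cancellable, then the converse holds. c) If $X_{\mathbb{M}}(S)$ is integral, then $S$ is integral and $I\neq\emptyset$; if $\mathbb{M}$ is torsionfree and cancellable, then the converse holds. d) If $X_{\mathbb{M}}(S)$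 is normal, then $S$ is normal or $I=\emptyset$; if $\mathbb{M}$ is torsionfree and integrally closed, then the converse holds (that is, if $S$ is normal or $I=\emptyset$, then $X_{\mathbb{M}}(S)$ is normal). -/

import Mathlib

open CategoryTheory CategoryTheory.Limits AlgebraicGeometry

universe u

namespace MonoidSystem

noncomputable section

/-- The functor sending a commutative additive monoid `M` to its algebra `ℤ[M]`. -/
def intAlgebra : AddCommMonCat.{u} ⥤ CommRingCat.{u} where
  obj M := CommRingCat.of (AddMonoidAlgebra ℤ M)
  map f := CommRingCat.ofHom (AddMonoidAlgebra.mapDomainRingHom ℤ f.hom)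
  map_id _ := CommRingCat.hom_ext (AddMonoidAlgebra.mapDomainRingHom_id)
  map_comp f g := CommRingCat.hom_ext (AddMonoidAlgebra.mapDomainRingHom_comp g.hom f.hom)

variable {I : Type u} [SemilatticeInf I]

/-- For a projective system `M = ((M i), (p i j : M j → M i for i ≤ j))` of monoids over `I`, the
inductive system of affine schemes `Spec ℤ[M i]`, with transition morphisms `Spec ℤ[p i j]`. -/
def charts (M : Iᵒᵖ ⥤ AddCommMonCat.{u}) : I ⥤ Scheme.{u} :=
  (M ⋙ intAlgebra).rightOp ⋙ Scheme.Spec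

/-- `M` is openly immersive: `Spec ℤ[M i] ⟶ Spec ℤ[M j]` is an open immersion for `i ≤ j`. -/
def IsOpenlyImmersive (M : Iᵒᵖ ⥤ AddCommMonCat.{u}) : Prop :=
  ∀ (i j : I) (h : i ≤ j), IsOpenImmersion ((charts M).map (homOfLE h))

/-- The affine schemes `Spec ℤ[M i]` can be glued: their inductive system has an inductive limit
in the category of schemes, and every canonical morphism to it is an open immersion. (This does
not follow from `IsOpenlyImmersive`: going around a cycle of charts in `I` may induce a nontrivial
automorphism of one of them.) -/
structure IsGluable (M : Iᵒᵖ ⥤ AddCommMonCat.{u}) : Prop where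
  hasColimit : HasColimit (charts M)
  isOpenImmersion_ι : ∀ i : I, IsOpenImmersion (colimit.ι (charts M) i)

/-- A concrete criterion: an openly immersive system is gluable as soon as, inside `Spec ℤ[M k]`,
the open subschemes `Spec ℤ[M i]` and `Spec ℤ[M j]` intersect in `Spec ℤ[M (i ⊓ j)]`, for all
`i, j ≤ k`. -/
theorem IsOpenlyImmersive.isGluable {M : Iᵒᵖ ⥤ AddCommMonCat.{u}} (hM : IsOpenlyImmersive M)
    (h : ∀ (i j k : I) (hi : i ≤ k) (hj : j ≤ k),
      Set.range ((charts M).map (homOfLE hi)) ∩ Set.range ((charts M).map (homOfLE hj)) ⊆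
        Set.range ((charts M).map (homOfLE (inf_le_left.trans hi : i ⊓ j ≤ k)))) :
    IsGluable M := by
  have (i j : I) (f : i ⟶ j) : IsOpenImmersion ((charts M).map f) := hM i j (leOfHom f)
  have : (charts M ⋙ Scheme.forget).IsLocallyDirected := by
    constructor
    intro i j k fi fj xi xj hx
    obtain ⟨z, hz⟩ := h i j k (leOfHom fi) (leOfHom fj) ⟨⟨xi, rfl⟩, ⟨xj, hx.symm⟩⟩
    refine ⟨i ⊓ j, homOfLE inf_le_left, homOfLE inf_le_right, z, ?_, ?_⟩
    · apply ((charts M).map fi).isOpenEmbedding.injective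
      refine Eq.trans ?_ hz
      change ((charts M).map _ ≫ (charts M).map _) z = _
      rw [← Functor.map_comp]
      rfl
    · apply ((charts M).map fj).isOpenEmbedding.injective
      refine Eq.trans ?_ (hz.trans hx)
      change ((charts M).map _ ≫ (charts M).map _) z = _
      rw [← Functor.map_comp]
      rfl
  exact ⟨inferInstance, inferInstance⟩

/-- The scheme `X_M(ℤ)`: the inductive limit of the affine schemes `Spec ℤ[M i]`. -/
def schemeInt (M : Iᵒᵖ ⥤ AddCommMonCat.{u}) (hG : IsGluable M) : Scheme.{u} :=
  haveI := hG.hasColimit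
  colimit (charts M)

/-- The scheme `X_M(S) = X_M(ℤ) × S`. -/
def scheme (M : Iᵒᵖ ⥤ AddCommMonCat.{u}) (hG : IsGluable M) (S : Scheme.{u}) : Scheme.{u} :=
  schemeInt M hG ⨯ S

/-- Every `M i` is torsionfree: `r m = r n` implies `m = n` for every integer `r ≥ 1`. -/
def IsTorsionFree (M : Iᵒᵖ ⥤ AddCommMonCat.{u}) : Prop :=
  ∀ i : I, IsAddTorsionFree (M.obj (Opposite.op i))

/-- Every `M i` is cancellable: `m + k = m + l` implies `k = l`. -/
def IsCancellable (M : Iᵒᵖ ⥤ AddCommMonCat.{u}) : Prop :=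
  ∀ i : I, IsCancelAdd (M.obj (Opposite.op i))

/-- Every `M i` is of finite type, i.e. generated by a finite subset. -/
def IsOfFiniteType (M : Iᵒᵖ ⥤ AddCommMonCat.{u}) : Prop :=
  ∀ i : I, AddMonoid.FG (M.obj (Opposite.op i))

/-- A commutative monoid is integrally closed if it is cancellable and contains every element `d`
of its group of differences such that `r d` lies in the monoid for some integer `r ≥ 1`. -/
def IsIntegrallyClosedMonoid (A : Type u) [AddCommMonoid A] : Prop :=
  IsCancelAdd A ∧ ∀ (d : Algebra.GrothendieckAddGroup A) (r : ℕ), 1 ≤ r →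
    r • d ∈ Set.range (Algebra.GrothendieckAddGroup.of (M := A)) →
    d ∈ Set.range (Algebra.GrothendieckAddGroup.of (M := A))

/-- Every `M i` is integrally closed. -/
def IsIntegrallyClosedSystem (M : Iᵒᵖ ⥤ AddCommMonCat.{u}) : Prop :=
  ∀ i : I, IsIntegrallyClosedMonoid (M.obj (Opposite.op i))

/-- A scheme is normal if all its stalks are integrally closed integral domains. -/
def IsNormalScheme (X : Scheme.{u}) : Prop :=
  ∀ x : X, IsDomain (X.presheaf.stalk x) ∧ IsIntegrallyClosed (X.presheaf.stalk x)

end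

end MonoidSystem

/-!
Let `p : X_M(S) ⟶ S` be the projection. Everything rests on two facts about it.

* For nonempty `I`, the augmentation `ℤ[M i] → ℤ` of any one chart gives a section of `p`. Hence `p`
  is surjective and every local ring of `S` is a retract of a local ring of `X_M(S)`. Connectedness
  and irreducibility pass to images, and being reduced or an integrally closed domain passes to
  retracts; this gives the descent of all four properties from `X_M(S)` to `S`.
* `X_M(S)` is covered by open subschemes `Spec A[M i]` with `Spec A ⊆ S` open
  (`MonoidAtlas.exists_chart_eq`), and `p` restricts to the structure morphism
  `Spec A[M i] ⟶ Spec A`.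

For the converses suppose that the monoids are torsionfree and cancellable, so that `A[M i]` is a
domain for every domain `A`. The fibres of `p` are geometrically irreducible: over a field `K` they
are unions of the irreducible open sets `Spec K[M i]`, and any two of these meet, since
`Spec K[M (i ⊓ j)]` lies in both. Moreover `p` is open, because the image of `D(f)` under
`Spec A[M] ⟶ Spec A` is the union of the `D(a)` for the coefficients `a` of `f`
(`AddMonoidAlgebra.image_comap_algebraMap_basicOpen`). An open surjection with connected
(irreducible) fibres and connected (irreducible) target has connected (irreducible) source; no
finiteness is needed. Reducedness, and with it integrality, is clear on charts.

Normality comes down to the following theorem: if `A` is an integrally closed domain and `M` is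
torsionfree and integrally closed, then `A[M]` is integrally closed
(`MonoidSystem.IsIntegrallyClosedMonoid.isIntegrallyClosed_addMonoidAlgebra`). Let `G` be the group
of differences of `M`. The ring `A[G]` is a filtered union of Laurent polynomial rings over `A`,
hence integrally closed, and it remains to see that `A[M]` is integrally closed in `A[G]`. If
`f ∈ A[G]` is integral over `A[M]`, then twisting by the powers of an injective character of `G` and
applying Lagrange interpolation shows that each monomial `a g` of `f` is integral over `L[M]`, for
some field `L` containing `A`. Comparing coefficients in an equation of integral dependence yields
`r g ∈ M` for some `r ≥ 1`, and hence `g ∈ M`.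
-/

/-! ### Monoid algebras of torsionfree cancellable monoids -/

namespace AddMonoidAlgebra

/-- A torsionfree cancellable monoid embeds into the rational vector space `ℚ ⊗ G`, where `G` is its
group of differences. -/
theorem twoUniqueSums_of_isAddTorsionFree (M : Type*) [AddCommMonoid M] [IsCancelAdd M]
    [IsAddTorsionFree M] : TwoUniqueSums M := by
  let _ : AddCancelCommMonoid M := { ‹AddCommMonoid M›, ‹IsCancelAdd M› with }
  exact .of_injective_addHom
    ((DivisibleHull.coeAddMonoidHom (M := Algebra.GrothendieckAddGroup M)).comp
      (Algebra.GrothendieckAddGroup.of (M := M))).toAddHom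
    (DivisibleHull.coe_injective.comp Algebra.GrothendieckAddGroup.of_injective) inferInstance

theorem isDomain_of_isAddTorsionFree (A M : Type*) [CommRing A] [IsDomain A] [AddCommMonoid M]
    [IsCancelAdd M] [IsAddTorsionFree M] : IsDomain (AddMonoidAlgebra A M) :=
  have := twoUniqueSums_of_isAddTorsionFree M
  inferInstance

section Localization

attribute [local instance] AddMonoidAlgebra.algebraAddMonoidAlgebra

/-- If `B` is the localization of `A` at `T`, then `B[M]` is the localization of `A[M]` at `T`. -/
theorem isLocalization_map_algebraMap {A : Type*} (B M : Type*) [CommRing A] [CommRing B]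
    [Algebra A B] [AddCommMonoid M] (T : Submonoid A) [IsLocalization T B] :
    IsLocalization (T.map (algebraMap A (AddMonoidAlgebra A M))) (AddMonoidAlgebra B M) := by
  have htower : IsScalarTower A (AddMonoidAlgebra A M) (AddMonoidAlgebra B M) :=
    .of_algebraMap_eq fun a ↦ by simp [RingHom.algebraMap_toAlgebra]
  exact isLocalizedModule_iff_isLocalization.mp <|
    (isLocalizedModule_iff_isBaseChange T B _).mpr <|
      .of_equiv (scalarTensorEquiv A B).toLinearEquiv fun x ↦ by
        induction x using AddMonoidAlgebra.induction_linear <;> simp_all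

end Localization

end AddMonoidAlgebra

/-! ### Integral closedness of group algebras -/

/-- A domain is integrally closed if every finite subset lies in an integrally closed subring: a
fraction and an equation of integral dependence for it involve only finitely many elements. -/
theorem IsIntegrallyClosed.of_forall_finset {R : Type*} [CommRing R] [IsDomain R]
    (h : ∀ s : Finset R, ∃ S : Subring R, IsIntegrallyClosed S ∧ (s : Set R) ⊆ S) :
    IsIntegrallyClosed R := by
  classical
  refine (isIntegrallyClosed_iff (FractionRing R)).mpr fun {x} ⟨p, hp, hpx⟩ ↦ ?_
  obtain ⟨a, b, hb, rfl⟩ := IsFractionRing.div_surjective (A := R) x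
  obtain ⟨S, hS, hsS⟩ := h ({a, b} ∪ p.coeffs)
  have haS : a ∈ S := hsS (by simp)
  have hbS : b ∈ S := hsS (by simp)
  have hpS : (p.coeffs : Set R) ⊆ S := fun c hc ↦ hsS (by simp [Finset.mem_coe.mp hc])
  have hinj : Function.Injective (algebraMap S (FractionRing R)) :=
    (IsFractionRing.injective R (FractionRing R)).comp Subtype.val_injective
  let φ : FractionRing S →ₐ[S] FractionRing R :=
    IsFractionRing.liftAlgHom (g := Algebra.ofId S (FractionRing R)) hinj
  let y : FractionRing S := algebraMap S _ ⟨a, haS⟩ / algebraMap S _ ⟨b, hbS⟩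
  have hy : φ y = algebraMap R _ a / algebraMap R _ b := by
    simp only [y, map_div₀, AlgHom.commutes]
    rfl
  have hint : IsIntegral S y := by
    refine ⟨p.toSubring S hpS, (Polynomial.monic_toSubring p S hpS).mpr hp,
      φ.toRingHom.injective ?_⟩
    rw [map_zero, ← hpx, ← hy]
    conv_rhs => rw [← Polynomial.map_toSubring p S hpS, Polynomial.eval₂_map]
    rw [Polynomial.hom_eval₂]
    congr 1
    ext c
    exact φ.commutes c
  obtain ⟨c, hc⟩ := (IsIntegrallyClosed.isIntegral_iff).mp hint
  refine ⟨c, ?_⟩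
  rw [← hy, ← hc, AlgHom.commutes]
  rfl

namespace AddMonoidAlgebra

theorem isIntegrallyClosed_int (A : Type*) [CommRing A] [IsDomain A] [IsIntegrallyClosed A] :
    IsIntegrallyClosed (AddMonoidAlgebra A ℤ) :=
  isIntegrallyClosed_of_isLocalization (R := Polynomial A) (LaurentPolynomial A)
    (Submonoid.powers Polynomial.X)
    (powers_le_nonZeroDivisors_of_noZeroDivisors Polynomial.X_ne_zero)

theorem isIntegrallyClosed_fin_int (n : ℕ) (A : Type*) [CommRing A] [IsDomain A]
    [IsIntegrallyClosed A] : IsIntegrallyClosed (AddMonoidAlgebra A (Fin n → ℤ)) := by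
  induction n with
  | zero => exact .of_equiv (uniqueRingEquiv (Fin 0 → ℤ)).symm
  | succ n ih =>
    have := isDomain_of_isAddTorsionFree A (Fin n → ℤ)
    have := isIntegrallyClosed_int (AddMonoidAlgebra A (Fin n → ℤ))
    exact .of_equiv ((curryRingEquiv (R := A) (M := ℤ) (N := Fin n → ℤ)).symm.trans
      (mapDomainRingEquiv A (Fin.consLinearEquiv ℤ fun _ : Fin (n + 1) ↦ ℤ).toAddEquiv))

/-- Every finite subset of `A[G]` lies in `A[H]` for a finitely generated subgroup `H` of `G`, and
`A[H]` is a ring of Laurent polynomials since `H` is free. -/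
theorem isIntegrallyClosed_of_addGroup (A G : Type*) [CommRing A] [IsDomain A]
    [IsIntegrallyClosed A] [AddCommGroup G] [IsAddTorsionFree G] :
    IsIntegrallyClosed (AddMonoidAlgebra A G) := by
  classical
  have := isDomain_of_isAddTorsionFree A G
  refine .of_forall_finset fun s ↦ ?_
  let H : AddSubgroup G := AddSubgroup.closure (s.biUnion fun f ↦ f.coeff.support)
  have hinj := mapDomain_injective (R := A) H.subtype_injective
  refine ⟨(mapDomainRingHom A H.subtype).range, ?_, fun f hf ↦ ?_⟩
  · have : AddGroup.FG H := (AddGroup.fg_iff_addSubgroup_fg _).mpr ⟨_, rfl⟩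
    have : Module.Finite ℤ H := Module.Finite.iff_addGroup_fg.mpr this
    have : IsAddTorsionFree H := H.subtype_injective.isAddTorsionFree H.subtype
    let b := Module.finBasis ℤ H
    have := isIntegrallyClosed_fin_int (Module.finrank ℤ H) A
    exact .of_equiv ((mapDomainRingEquiv A b.equivFun.symm.toAddEquiv).trans
      (RingEquiv.ofBijective (mapDomainRingHom A H.subtype).rangeRestrict
        ⟨fun x y h ↦ hinj (congrArg Subtype.val h), RingHom.rangeRestrict_surjective _⟩))
  · refine ⟨comapDomain _ H.subtype_injective f, mapDomain_comapDomain (fun g hg ↦ ?_) _⟩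
    simp only [AddSubgroup.coe_subtype, Subtype.range_coe_subtype]
    exact AddSubgroup.subset_closure (by
      simp only [Finset.coe_biUnion, Set.mem_iUnion]
      exact ⟨f, hf, hg⟩)

end AddMonoidAlgebra

/-! ### Integral closedness of monoid algebras -/

namespace AddMonoidAlgebra

/-- If a monomial `a g` with `a ≠ 0` is integral over `L[M]`, of degree `n`, then the term `aⁿ (n
g)` of the equation has to cancel against some term `c (i g)` with `c ∈ L[M]` and `i < n`, so that
`(n - i) g` lies in `M`. -/
theorem exists_nsmul_mem_range_of_isIntegralElem_single {L M G : Type*} [CommRing L] [IsDomain L]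
    [AddCommMonoid M] [AddCommGroup G] (ι : M →+ G) {g : G} {a : L} (ha : a ≠ 0)
    (h : (mapDomainRingHom L ι).IsIntegralElem (single g a)) :
    ∃ r : ℕ, 1 ≤ r ∧ r • g ∈ Set.range ι := by
  obtain ⟨p, hp, hpg⟩ := h
  by_contra! hr
  -- Compare the coefficients of `n g` in the equation, where `n` is its degree.
  have hcoeff := congrArg (fun x ↦ x.coeff (p.natDegree • g)) hpg
  simp only [Polynomial.eval₂_eq_sum_range, single_pow, coeff_sum, Finsupp.finsetSum_apply]
    at hcoeff
  have key : ∀ i, ((mapDomainRingHom L ι (p.coeff i)) * single (i • g) (a ^ i)).coeff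
      (p.natDegree • g) =
      (mapDomain ι (p.coeff i)).coeff (p.natDegree • g - i • g) * a ^ i := by
    intro i
    rw [coeff_mul_single_eq_coeff_mul (m₂ := p.natDegree • g - i • g) (H := fun m _ ↦ by
      rw [eq_sub_iff_add_eq])]
    rfl
  rw [Finset.sum_range_succ, Finset.sum_eq_zero, key] at hcoeff
  · simp [hp.coeff_natDegree, one_def, ha] at hcoeff
  · intro i hi
    rw [key]
    have : p.natDegree • g - i • g = (p.natDegree - i) • g := by
      rw [sub_nsmul _ (Finset.mem_range.mp hi).le, sub_eq_add_neg]
    rw [this]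
    have := hr (p.natDegree - i) (by have := Finset.mem_range.mp hi; omega)
    rw [show (mapDomain ι (p.coeff i)).coeff ((p.natDegree - i) • g) = 0 from
      Finsupp.mapDomain_of_notMem_range _ _ this, zero_mul]

/-- If `f ∈ A[G]` is integral over `A[M]`, then each of its monomials is integral over `L[M]`, for
any field `L` over `A` with an injective multiplicative character `χ : G → L`. For `j ≥ 0` the twist
`∑ h, χ(h)ʲ f(h) h` of `f` is integral over `L[M]`, and since the values `χ(h)` are distinct,
Lagrange interpolation writes each monomial of `f` as an `L`-linear combination of such twists. -/
theorem isIntegralElem_single_coeff {A M G : Type*} [CommRing A]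
    [AddCommMonoid M] [AddCommGroup G] (ι : M →+ G)
    (L : Type*) [Field L] [Algebra A L] (χ : Multiplicative G →* L) (hχ : Function.Injective χ)
    {f : AddMonoidAlgebra A G} (hf : (mapDomainRingHom A ι).IsIntegralElem f)
    {g : G} (hg : g ∈ f.coeff.support) :
    (mapDomainRingHom L ι).IsIntegralElem (single g (algebraMap A L (f.coeff g))) := by
  classical
  let _ : Algebra (AddMonoidAlgebra L M) (AddMonoidAlgebra L G) := (mapDomainRingHom L ι).toAlgebra
  -- The twists by `χʲ` on `A[G]` and on `A[M]` are compatible, so they preserve integrality.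
  let φ (j : ℕ) : AddMonoidAlgebra A G →ₐ[A] AddMonoidAlgebra L G :=
    lift A (AddMonoidAlgebra L G) G
      { toFun := fun g ↦ single g.toAdd (χ g ^ j)
        map_one' := by simp [one_def]
        map_mul' := fun x y ↦ by simp [single_mul_single, mul_pow] }
  let ψ (j : ℕ) : AddMonoidAlgebra A M →ₐ[A] AddMonoidAlgebra L M :=
    lift A (AddMonoidAlgebra L M) M
      { toFun := fun m ↦ single m.toAdd (χ (.ofAdd (ι m.toAdd)) ^ j)
        map_one' := by simp [one_def]
        map_mul' := fun x y ↦ by simp [single_mul_single, mul_pow] }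
  have hφψ (j : ℕ) : (φ j).toRingHom.comp (mapDomainRingHom A ι) =
      (mapDomainRingHom L ι).comp (ψ j).toRingHom := by
    ext <;> simp [φ, ψ]
  have hint (j : ℕ) : IsIntegral (AddMonoidAlgebra L M) (φ j f) := by
    have : ((φ j).toRingHom.comp (mapDomainRingHom A ι)).IsIntegralElem (φ j f) := by
      obtain ⟨p, hp, hpf⟩ := hf
      refine ⟨p, hp, ?_⟩
      exact (Polynomial.hom_eval₂ p _ (φ j).toRingHom f).symm.trans (by rw [hpf, map_zero])
    rw [hφψ] at this
    exact this.of_comp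
  have hφf (j : ℕ) : φ j f = ∑ h ∈ f.coeff.support,
      single h (χ (.ofAdd h) ^ j * algebraMap A L (f.coeff h)) := by
    simp [φ, lift_apply, Finsupp.sum, Algebra.smul_def, mul_comm]
  -- The polynomial `P` takes the value `1` at `χ(g)` and vanishes at the other `χ(h)`.
  let P : Polynomial L := Lagrange.basis f.coeff.support (fun h ↦ χ (.ofAdd h)) g
  have hP : single g (algebraMap A L (f.coeff g)) =
      ∑ j ∈ Finset.range (P.natDegree + 1),
        algebraMap (AddMonoidAlgebra L M) (AddMonoidAlgebra L G) (single 0 (P.coeff j)) *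
          φ j f := by
    have hχ' : Set.InjOn (fun h ↦ χ (.ofAdd h)) (f.coeff.support : Set G) :=
      fun x _ y _ hxy ↦ Multiplicative.ofAdd.injective (hχ hxy)
    simp only [hφf, Finset.mul_sum, RingHom.algebraMap_toAlgebra]
    have hterm (h : G) : ∑ j ∈ Finset.range (P.natDegree + 1),
        (mapDomainRingHom L ι (single 0 (P.coeff j)) : AddMonoidAlgebra L G) *
          single h (χ (.ofAdd h) ^ j * algebraMap A L (f.coeff h)) =
        single h (P.eval (χ (.ofAdd h)) * algebraMap A L (f.coeff h)) := by
      rw [Polynomial.eval_eq_sum_range, Finset.sum_mul]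
      refine .trans (Finset.sum_congr rfl fun j _ ↦ ?_) (map_sum (singleAddHom h) _ _).symm
      simp [single_mul_single, mul_assoc]
    rw [Finset.sum_comm, Finset.sum_eq_single_of_mem g hg, hterm]
    · rw [Lagrange.eval_basis_self hχ' hg, one_mul]
    · intro h hh hne
      have h0 : P.eval (χ (.ofAdd h)) = 0 :=
        Lagrange.eval_basis_of_ne (v := fun h ↦ χ (.ofAdd h)) hne.symm hh
      rw [hterm, h0, zero_mul, single_zero]
  change IsIntegral _ _
  rw [hP]
  exact .sum _ fun j _ ↦ isIntegral_algebraMap.mul (hint j)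

/-- If `M ⊆ G` is closed under division by positive integers, then `A[M]` is integrally closed in
`A[G]`. -/
theorem mem_range_mapDomainRingHom_of_isIntegralElem {A M G : Type*} [CommRing A] [IsDomain A]
    [AddCommMonoid M] [AddCommGroup G] [IsAddTorsionFree G] (ι : M →+ G)
    (hι : Function.Injective ι)
    (hM : ∀ (g : G) (r : ℕ), 1 ≤ r → r • g ∈ Set.range ι → g ∈ Set.range ι)
    {f : AddMonoidAlgebra A G} (hf : (mapDomainRingHom A ι).IsIntegralElem f) :
    ∃ x, mapDomainRingHom A ι x = f := by
  refine ⟨comapDomain ι hι f, mapDomain_comapDomain (fun g hg ↦ ?_) _⟩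
  have := isDomain_of_isAddTorsionFree A G
  -- The tautological map from `G` to the fraction field of `A[G]` is an injective character.
  let L := FractionRing (AddMonoidAlgebra A G)
  have hL : Function.Injective (algebraMap A L) := by
    rw [IsScalarTower.algebraMap_eq A (AddMonoidAlgebra A G) L]
    exact (IsFractionRing.injective (AddMonoidAlgebra A G) L).comp (single_right_injective (m := 0))
  have hint := isIntegralElem_single_coeff ι L
    ((algebraMap (AddMonoidAlgebra A G) L).toMonoidHom.comp (of A G))
    ((IsFractionRing.injective (AddMonoidAlgebra A G) L).comp of_injective) hf hg
  obtain ⟨r, hr, hrg⟩ := exists_nsmul_mem_range_of_isIntegralElem_single ι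
    (fun h ↦ Finsupp.mem_support_iff.mp hg (hL (h.trans (map_zero _).symm))) hint
  exact hM g r hr hrg

end AddMonoidAlgebra

/-- The algebra of a torsionfree integrally closed monoid over an integrally closed domain is
integrally closed, being integrally closed in the algebra of the group of differences. -/
theorem MonoidSystem.IsIntegrallyClosedMonoid.isIntegrallyClosed_addMonoidAlgebra {M : Type u}
    [AddCommMonoid M] [IsAddTorsionFree M] (hM : IsIntegrallyClosedMonoid M) (A : Type*)
    [CommRing A] [IsDomain A] [IsIntegrallyClosed A] :
    IsIntegrallyClosed (AddMonoidAlgebra A M) := by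
  have := hM.1
  let G := Algebra.GrothendieckAddGroup M
  let ι : M →+ G := Algebra.GrothendieckAddGroup.of
  have hι : Function.Injective ι := Algebra.GrothendieckAddGroup.of_injective
  let _ : Algebra (AddMonoidAlgebra A M) (AddMonoidAlgebra A G) :=
    (AddMonoidAlgebra.mapDomainRingHom A ι).toAlgebra
  have hinj : Function.Injective (algebraMap (AddMonoidAlgebra A M) (AddMonoidAlgebra A G)) :=
    AddMonoidAlgebra.mapDomain_injective hι
  have := (faithfulSMul_iff_algebraMap_injective _ _).mpr hinj
  have := AddMonoidAlgebra.isDomain_of_isAddTorsionFree A G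
  have := AddMonoidAlgebra.isIntegrallyClosed_of_addGroup A G
  have : IsIntegrallyClosedIn (AddMonoidAlgebra A M) (AddMonoidAlgebra A G) :=
    isIntegrallyClosedIn_iff.mpr ⟨hinj, fun hx ↦
      AddMonoidAlgebra.mem_range_mapDomainRingHom_of_isIntegralElem ι hι hM.2 hx⟩
  exact .of_isIntegrallyClosed_of_isIntegrallyClosedIn _ (AddMonoidAlgebra A G)

/-! ### The morphism `Spec A[M] ⟶ Spec A` -/

namespace AddMonoidAlgebra

/-- The image of `D(f)` under `Spec A[M] ⟶ Spec A` is the union of the `D(a)`, for the coefficients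
`a` of `f`. If `a ∉ q` for one of them, then `f` does not lie in the kernel of `A[M] → (A ⧸ q)[M]`,
which is a prime ideal over `q`. -/
theorem image_comap_algebraMap_basicOpen {A M : Type*} [CommRing A] [AddCommMonoid M]
    [IsCancelAdd M] [IsAddTorsionFree M] (f : AddMonoidAlgebra A M) :
    PrimeSpectrum.comap (algebraMap A (AddMonoidAlgebra A M)) '' PrimeSpectrum.basicOpen f =
      (PrimeSpectrum.zeroLocus (Set.range f.coeff))ᶜ := by
  ext q
  simp only [Set.mem_image, SetLike.mem_coe, PrimeSpectrum.mem_basicOpen, Set.mem_compl_iff,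
    PrimeSpectrum.mem_zeroLocus, Set.range_subset_iff]
  constructor
  · rintro ⟨P, hP, rfl⟩ h
    refine hP ?_
    rw [← sum_coeff_single f]
    refine Ideal.sum_mem _ fun m _ ↦ ?_
    have : single m (f.coeff m) = algebraMap A (AddMonoidAlgebra A M) (f.coeff m) * single m 1 := by
      simp [single_mul_single]
    rw [this]
    exact Ideal.mul_mem_right _ _ (h m)
  · intro h
    push Not at h
    obtain ⟨m, hm⟩ := h
    have := isDomain_of_isAddTorsionFree (A ⧸ q.asIdeal) M
    let φ : AddMonoidAlgebra A M →+* AddMonoidAlgebra (A ⧸ q.asIdeal) M :=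
      mapRingHom M (Ideal.Quotient.mk q.asIdeal)
    have hφ (x) : φ x = 0 ↔ ∀ m, x.coeff m ∈ q.asIdeal := by
      simp [φ, AddMonoidAlgebra.ext_iff, Finsupp.ext_iff, Ideal.Quotient.eq_zero_iff_mem]
    refine ⟨PrimeSpectrum.comap φ ⊥, fun h ↦ hm ((hφ f).mp h m), ?_⟩
    ext a
    change φ (algebraMap _ _ a) = 0 ↔ _
    simp [φ, Ideal.Quotient.eq_zero_iff_mem]

theorem isOpenMap_comap_algebraMap (A M : Type*) [CommRing A] [AddCommMonoid M]
    [IsCancelAdd M] [IsAddTorsionFree M] :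
    IsOpenMap (PrimeSpectrum.comap (algebraMap A (AddMonoidAlgebra A M))) := by
  refine PrimeSpectrum.isTopologicalBasis_basic_opens.isOpenMap_iff.mpr ?_
  rintro _ ⟨f, rfl⟩
  rw [image_comap_algebraMap_basicOpen]
  exact (PrimeSpectrum.isClosed_zeroLocus _).isOpen_compl

end AddMonoidAlgebra

/-- If the prime `P` of `A[M]` lies over `q`, then `A[M]_P` is a localization of `A_q[M]`. Hence it
is an integrally closed domain if `A_q` is. -/
theorem MonoidSystem.IsIntegrallyClosedMonoid.isIntegrallyClosed_localization {M : Type u}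
    [AddCommMonoid M] [IsAddTorsionFree M] (hM : IsIntegrallyClosedMonoid M) {A : Type*}
    [CommRing A] (P : Ideal (AddMonoidAlgebra A M)) [P.IsPrime] (q : Ideal A) [q.IsPrime]
    (hq : P.comap (algebraMap A (AddMonoidAlgebra A M)) = q)
    (h : IsDomain (Localization.AtPrime q) ∧ IsIntegrallyClosed (Localization.AtPrime q)) :
    IsDomain (Localization.AtPrime P) ∧ IsIntegrallyClosed (Localization.AtPrime P) := by
  have := hM.1
  obtain ⟨_, _⟩ := h
  let B := Localization.AtPrime q
  let _ : Algebra (AddMonoidAlgebra A M) (AddMonoidAlgebra B M) :=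
    AddMonoidAlgebra.algebraAddMonoidAlgebra
  let T := q.primeCompl.map (algebraMap A (AddMonoidAlgebra A M))
  have : IsLocalization T (AddMonoidAlgebra B M) :=
    AddMonoidAlgebra.isLocalization_map_algebraMap B M q.primeCompl
  have hT : T ≤ P.primeCompl := by
    rintro _ ⟨a, ha, rfl⟩ h
    exact ha (hq ▸ h)
  let _ : Algebra (AddMonoidAlgebra B M) (Localization.AtPrime P) :=
    IsLocalization.localizationAlgebraOfSubmonoidLe _ _ T P.primeCompl hT
  have := IsLocalization.localization_isScalarTower_of_submonoid_le (AddMonoidAlgebra B M)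
    (Localization.AtPrime P) T P.primeCompl hT
  have hloc := IsLocalization.isLocalization_of_submonoid_le (AddMonoidAlgebra B M)
    (Localization.AtPrime P) T P.primeCompl hT
  have := AddMonoidAlgebra.isDomain_of_isAddTorsionFree B M
  have := hM.isIntegrallyClosed_addMonoidAlgebra B
  have hle : P.primeCompl.map (algebraMap (AddMonoidAlgebra A M) (AddMonoidAlgebra B M)) ≤
      nonZeroDivisors _ := by
    refine le_nonZeroDivisors_of_noZeroDivisors fun h0 ↦ ?_
    have := (IsLocalization.AtPrime.isLocalRing (Localization.AtPrime P) P)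
    exact not_nontrivial_iff_subsingleton.mpr
      (IsLocalization.subsingleton (S := Localization.AtPrime P) h0) inferInstance
  exact ⟨IsLocalization.isDomain_of_le_nonZeroDivisors _ hle,
    isIntegrallyClosed_of_isLocalization _ _ hle⟩

/-- A retract of an integrally closed domain is an integrally closed domain: if `a / b` is integral
over `A`, then `a = b c` in the larger ring, and applying the retraction shows that `b` divides `a`
in `A`. -/
theorem isDomain_and_isIntegrallyClosed_of_comp_eq_id {A B : Type*} [CommRing A] [CommRing B]
    [IsDomain B] [IsIntegrallyClosed B] (f : A →+* B) (r : B →+* A) (h : r.comp f = .id A) :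
    IsDomain A ∧ IsIntegrallyClosed A := by
  have hrf (a : A) : r (f a) = a := RingHom.congr_fun h a
  have hf : Function.Injective f := Function.LeftInverse.injective hrf
  have := hf.isDomain f
  refine ⟨this, (isIntegrallyClosed_iff (FractionRing A)).mpr fun {x} hx ↦ ?_⟩
  obtain ⟨a, b, hb, rfl⟩ := IsFractionRing.div_surjective (A := A) x
  let φ : FractionRing A →+* FractionRing B :=
    IsFractionRing.map (A := A) (B := B) hf
  have hφ (a : A) : φ (algebraMap A _ a) = algebraMap B _ (f a) := by simp [φ, IsFractionRing.map]
  have hint : IsIntegral B (φ (algebraMap A _ a / algebraMap A _ b)) := by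
    have := hx.map_of_comp_eq f φ (by ext a; simp [hφ])
    exact this
  obtain ⟨c, hc⟩ := IsIntegrallyClosed.isIntegral_iff.mp hint
  have hb0 : b ≠ 0 := nonZeroDivisors.ne_zero hb
  have hfb : algebraMap B (FractionRing B) (f b) ≠ 0 := by
    simpa [hf.eq_iff' (map_zero f)] using hb0
  rw [map_div₀, hφ, hφ, eq_div_iff hfb, ← map_mul] at hc
  have hcb : r c * b = a := by
    have := congrArg r (IsFractionRing.injective B (FractionRing B) hc)
    simpa [hrf] using this
  refine ⟨r c, ?_⟩
  rw [eq_div_iff, ← map_mul, hcb]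
  simpa using hb0

/-! ### Irreducible spaces and products -/

theorem irreducibleSpace_of_isOpen_of_inter_nonempty {X ι : Type*} [TopologicalSpace X] [Nonempty ι]
    (U : ι → Set X) (hU : ∀ i, IsOpen (U i)) (hirr : ∀ i, IsIrreducible (U i))
    (hmeet : ∀ i j, (U i ∩ U j).Nonempty) (hcover : ∀ x, ∃ i, x ∈ U i) : IrreducibleSpace X := by
  have : Nonempty X := ⟨(hirr (Classical.arbitrary ι)).nonempty.some⟩
  refine { toNonempty := this, isPreirreducible_univ := fun V W hV hW ⟨v, _, hv⟩ ⟨w, _, hw⟩ ↦ ?_ }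
  obtain ⟨i, hi⟩ := hcover v
  obtain ⟨j, hj⟩ := hcover w
  obtain ⟨x, hx, hxV, hxj⟩ := (hirr i).2 V (U j) hV (hU j) ⟨v, hi, hv⟩ (hmeet i j)
  obtain ⟨y, -, hyV, hyW⟩ := (hirr j).2 V W hV hW ⟨x, hxj, hxV⟩ ⟨w, hj, hw⟩
  exact ⟨y, trivial, hyV, hyW⟩

namespace CategoryTheory.Limits

variable {C : Type*} [Category* C] [HasBinaryProducts C]

theorem isPullback_prodMap_id_right {X Y : C} (f : Y ⟶ X) (S : C) :
    IsPullback (prod.map f (𝟙 S)) prod.fst prod.fst f := by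
  refine .mk' (by simp) (fun T φ φ' h₁ h₂ ↦ ?_) fun T a b h ↦ ?_
  · ext
    · exact h₂
    · simpa using congrArg (· ≫ prod.snd) h₁
  · refine ⟨prod.lift b (a ≫ prod.snd), ?_, prod.lift_fst _ _⟩
    ext
    · rw [Category.assoc, prod.map_fst, prod.lift_fst_assoc, h]
    · rw [Category.assoc, prod.map_snd, prod.lift_snd_assoc, Category.comp_id]

theorem isPullback_prodMap_id_left {S T : C} (X : C) (g : T ⟶ S) :
    IsPullback (prod.map (𝟙 X) g) prod.snd prod.snd g := by
  refine .mk' (by simp) (fun T φ φ' h₁ h₂ ↦ ?_) fun T a b h ↦ ?_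
  · ext
    · simpa using congrArg (· ≫ prod.fst) h₁
    · exact h₂
  · refine ⟨prod.lift (a ≫ prod.fst) b, ?_, prod.lift_snd _ _⟩
    ext
    · rw [Category.assoc, prod.map_fst, prod.lift_fst_assoc, Category.comp_id]
    · rw [Category.assoc, prod.map_snd, prod.lift_snd_assoc, h]

end CategoryTheory.Limits

namespace AddMonoidAlgebra

variable {A M T : Type*} [CommRing A] [AddCommMonoid M] [CommRing T]

/-- The ring homomorphism `A[M] → T` induced by ring homomorphisms `ℤ[M] → T` and `A → T`. It
exhibits `A[M]` as the coproduct of `ℤ[M]` and `A` in the category of commutative rings. -/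
noncomputable def liftOfInt (f : AddMonoidAlgebra ℤ M →+* T) (g : A →+* T) :
    AddMonoidAlgebra A M →+* T :=
  liftNCRingHom g ((f : AddMonoidAlgebra ℤ M →* T).comp (of ℤ M)) fun _ _ ↦ .all _ _

theorem liftOfInt_comp_mapRingHom (f : AddMonoidAlgebra ℤ M →+* T) (g : A →+* T) :
    (liftOfInt f g).comp (mapRingHom M (Int.castRingHom A)) = f :=
  ringHom_ext' (RingHom.ext_int _ _) (by ext; simp [liftOfInt])

theorem liftOfInt_comp_algebraMap (f : AddMonoidAlgebra ℤ M →+* T) (g : A →+* T) :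
    (liftOfInt f g).comp (algebraMap A (AddMonoidAlgebra A M)) = g := by
  ext; simp [liftOfInt, ← one_def]

theorem eq_liftOfInt (h : AddMonoidAlgebra A M →+* T) :
    h = liftOfInt (h.comp (mapRingHom M (Int.castRingHom A)))
      (h.comp (algebraMap A (AddMonoidAlgebra A M))) :=
  ringHom_ext' (by ext; simp [liftOfInt, ← one_def]) (by ext; simp [liftOfInt, ← one_def])

end AddMonoidAlgebra

namespace AlgebraicGeometry

theorem _root_.CategoryTheory.IsPullback.exists_preimage {P X Y Z : Scheme.{u}} {fst : P ⟶ X}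
    {snd : P ⟶ Y} {f : X ⟶ Z} {g : Y ⟶ Z} (h : IsPullback fst snd f g) (x : X) (y : Y)
    (hxy : f x = g y) : ∃ z : P, fst z = x ∧ snd z = y := by
  obtain ⟨z, hz₁, hz₂⟩ := Scheme.Pullback.exists_preimage_pullback x y hxy
  refine ⟨h.isoPullback.inv z, ?_, ?_⟩
  · rw [← Scheme.Hom.comp_apply, h.isoPullback_inv_fst, hz₁]
  · rw [← Scheme.Hom.comp_apply, h.isoPullback_inv_snd, hz₂]

instance {X Y S T : Scheme.{u}} (f : Y ⟶ X) (g : T ⟶ S) [IsOpenImmersion f] [IsOpenImmersion g] :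
    IsOpenImmersion (prod.map f g) := by
  have h₁ : IsOpenImmersion (prod.map f (𝟙 T)) :=
    MorphismProperty.of_isPullback (isPullback_prodMap_id_right f T).flip ‹_›
  have h₂ : IsOpenImmersion (prod.map (𝟙 X) g) :=
    MorphismProperty.of_isPullback (isPullback_prodMap_id_left X g).flip ‹_›
  have : prod.map f g = prod.map f (𝟙 T) ≫ prod.map (𝟙 X) g := by simp
  rw [this]
  infer_instance

theorem exists_prodMap_eq {X Y S T : Scheme.{u}} (f : Y ⟶ X) (g : T ⟶ S)
    (z : (X ⨯ S : Scheme.{u})) (y : Y) (t : T)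
    (hy : f y = (prod.fst : X ⨯ S ⟶ X) z) (ht : g t = (prod.snd : X ⨯ S ⟶ S) z) :
    ∃ w : (Y ⨯ T : Scheme.{u}), prod.map f g w = z := by
  obtain ⟨v, hv, -⟩ := (isPullback_prodMap_id_left X g).exists_preimage z t ht.symm
  obtain ⟨w, hw, -⟩ := (isPullback_prodMap_id_right f T).exists_preimage v y (by
    rw [hy, ← hv, ← Scheme.Hom.comp_apply, prod.map_fst, Category.comp_id])
  refine ⟨w, ?_⟩
  rw [← hv, ← hw, ← Scheme.Hom.comp_apply]
  simp

/-- `Spec A[M]` is the product of `Spec ℤ[M]` and `Spec A`. -/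
theorem isIso_prodLift_addMonoidAlgebra (A : CommRingCat.{u}) (M : AddCommMonCat.{u}) :
    IsIso (prod.lift
      (Spec.map (CommRingCat.ofHom (AddMonoidAlgebra.mapRingHom M (Int.castRingHom A))))
      (Spec.map (CommRingCat.ofHom (algebraMap A (AddMonoidAlgebra A M)))) :
        Spec (.of (AddMonoidAlgebra A M)) ⟶
          Spec (.of (AddMonoidAlgebra ℤ M)) ⨯ Spec A) := by
  let c : BinaryCofan (CommRingCat.of (AddMonoidAlgebra ℤ M)) A :=
    .mk (CommRingCat.ofHom (AddMonoidAlgebra.mapRingHom M (Int.castRingHom A)))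
      (CommRingCat.ofHom (algebraMap A (AddMonoidAlgebra A M)))
  have hc : IsColimit c := BinaryCofan.IsColimit.mk _
    (fun f g ↦ CommRingCat.ofHom (AddMonoidAlgebra.liftOfInt f.hom g.hom))
    (fun f g ↦ CommRingCat.hom_ext (AddMonoidAlgebra.liftOfInt_comp_mapRingHom f.hom g.hom))
    (fun f g ↦ CommRingCat.hom_ext (AddMonoidAlgebra.liftOfInt_comp_algebraMap f.hom g.hom))
    (fun f g m h₁ h₂ ↦ CommRingCat.hom_ext <| by
      subst h₁ h₂
      exact AddMonoidAlgebra.eq_liftOfInt m.hom)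
  have h := isPullback_SpecMap_of_isPushout _ _ _ _
    (IsPushout.of_isColimit_binaryCofan_of_isInitial hc CommRingCat.isInitial)
  have h' := IsPullback.of_isLimit_binaryFan_of_isTerminal
    (prodIsProd (Spec (.of (AddMonoidAlgebra ℤ M))) (Spec A)) specULiftZIsTerminal
  have h'' : IsPullback (Spec.map c.inl) (Spec.map c.inr)
      (specULiftZIsTerminal.from _) (specULiftZIsTerminal.from _) := by
    convert! h.flip using 1 <;> exact specULiftZIsTerminal.hom_ext _ _
  convert! (h''.isoIsPullback _ _ h').isIso_hom
  ext
  · rw [prod.lift_fst]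
    exact (h''.isoIsPullback_hom_fst _ _ h').symm
  · rw [prod.lift_snd]
    exact (h''.isoIsPullback_hom_snd _ _ h').symm

end AlgebraicGeometry

namespace AlgebraicGeometry

/-! ### Stalks -/

theorem isDomain_and_isIntegrallyClosed_iff_of_ringEquiv {A B : Type*} [CommRing A] [CommRing B]
    (e : A ≃+* B) :
    IsDomain A ∧ IsIntegrallyClosed A ↔ IsDomain B ∧ IsIntegrallyClosed B :=
  ⟨fun ⟨_, _⟩ ↦ ⟨e.symm.toMulEquiv.isDomain A, .of_equiv e⟩,
    fun ⟨_, _⟩ ↦ ⟨e.toMulEquiv.isDomain B, .of_equiv e.symm⟩⟩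

/-- The stalk of `X` at a point of an affine open immersion `Spec R ⟶ X` is the localization of `R`
at the corresponding prime ideal. -/
noncomputable def stalkEquivLocalization {X : Scheme.{u}} {R : CommRingCat.{u}} (f : Spec R ⟶ X)
    [IsOpenImmersion f] (y : PrimeSpectrum R) :
    X.presheaf.stalk (f y) ≃+* Localization.AtPrime y.asIdeal :=
  let x : Spec R := y
  (asIso (f.stalkMap x) ≪≫ Spec.stalkIso R y).commRingCatIsoToRingEquiv

/-- A section `σ` of a morphism `p : X ⟶ S` makes the local ring of `S` at `s` a retract of the
local ring of `X` at `σ s`. -/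
theorem exists_stalkMap_comp_eq_id {X S : Scheme.{u}} {σ : S ⟶ X} {p : X ⟶ S} (h : σ ≫ p = 𝟙 S)
    (s : S) : ∃ f : S.presheaf.stalk s →+* X.presheaf.stalk (σ s),
      (σ.stalkMap s).hom.comp f = .id _ := by
  have : IsIso (σ ≫ p) := h ▸ inferInstance
  let g : S.presheaf.stalk ((σ ≫ p) s) ⟶ X.presheaf.stalk (σ s) := p.stalkMap (σ s)
  have hg : g ≫ σ.stalkMap s = (σ ≫ p).stalkMap s := (Scheme.Hom.stalkMap_comp σ p s).symm
  refine ⟨(inv ((σ ≫ p).stalkMap s) ≫ g).hom, ?_⟩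
  rw [← CommRingCat.hom_comp, Category.assoc, hg, IsIso.inv_hom_id, CommRingCat.hom_id]

theorem isReduced_of_section {X S : Scheme.{u}} {σ : S ⟶ X} {p : X ⟶ S} (h : σ ≫ p = 𝟙 S)
    [IsReduced X] : IsReduced S := by
  have (s : S) : _root_.IsReduced (S.presheaf.stalk s) := by
    obtain ⟨f, hf⟩ := exists_stalkMap_comp_eq_id h s
    exact isReduced_of_injective f (Function.LeftInverse.injective
      (g := (σ.stalkMap s).hom) fun a ↦ RingHom.congr_fun hf a)
  exact isReduced_of_isReduced_stalk S

/-! ### Charts -/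

/-- A covering of a scheme `X` by open immersions `Spec ℤ[M i] ⟶ X`, with `M i` commutative monoids,
such that the images of any two of them contain the image of a third. -/
structure MonoidAtlas (I : Type u) (X : Scheme.{u}) where
  /-- The monoids whose algebras define the charts. -/
  monoid : I → AddCommMonCat.{u}
  /-- The charts. -/
  ι (i : I) : Spec (.of (AddMonoidAlgebra ℤ (monoid i))) ⟶ X
  isOpenImmersion_ι (i : I) : IsOpenImmersion (ι i)
  exists_ι_eq (x : X) : ∃ i y, ι i y = x
  exists_range_subset (i j : I) :
    ∃ k, Set.range (ι k) ⊆ Set.range (ι i) ∧ Set.range (ι k) ⊆ Set.range (ι j)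

namespace MonoidAtlas

variable {I : Type u} {X : Scheme.{u}} (𝒜 : MonoidAtlas I X) {S : Scheme.{u}}

instance (i : I) : IsOpenImmersion (𝒜.ι i) :=
  𝒜.isOpenImmersion_ι i

/-- For a morphism `t : Spec A ⟶ S`, the morphism `Spec A[M i] ⟶ X ⨯ S` with components
`Spec A[M i] ⟶ Spec ℤ[M i] ⟶ X` and `Spec A[M i] ⟶ Spec A ⟶ S`. -/
noncomputable def chart (i : I) {A : CommRingCat.{u}} (t : Spec A ⟶ S) :
    Spec (.of (AddMonoidAlgebra A (𝒜.monoid i))) ⟶ X ⨯ S :=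
  prod.lift
      (Spec.map (CommRingCat.ofHom (AddMonoidAlgebra.mapRingHom (𝒜.monoid i) (Int.castRingHom A))))
      (Spec.map (CommRingCat.ofHom (algebraMap A (AddMonoidAlgebra A (𝒜.monoid i))))) ≫
    prod.map (𝒜.ι i) t

instance (i : I) {A : CommRingCat.{u}} (t : Spec A ⟶ S) [IsOpenImmersion t] :
    IsOpenImmersion (𝒜.chart i t) := by
  have := isIso_prodLift_addMonoidAlgebra A (𝒜.monoid i)
  rw [chart]
  exact IsOpenImmersion.comp _ _

theorem chart_snd (i : I) {A : CommRingCat.{u}} (t : Spec A ⟶ S) :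
    𝒜.chart i t ≫ prod.snd =
      Spec.map (CommRingCat.ofHom (algebraMap A (AddMonoidAlgebra A (𝒜.monoid i)))) ≫ t := by
  rw [chart, Category.assoc, prod.map_snd, prod.lift_snd_assoc]

theorem snd_chart (i : I) {A : CommRingCat.{u}} (t : Spec A ⟶ S)
    (z : PrimeSpectrum (AddMonoidAlgebra A (𝒜.monoid i))) :
    (prod.snd : X ⨯ S ⟶ S) (𝒜.chart i t z) =
      t (PrimeSpectrum.comap (algebraMap A (AddMonoidAlgebra A (𝒜.monoid i))) z) :=
  congr($(𝒜.chart_snd i t) z)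

/-- The image of `Spec A[M i]` in `X ⨯ S` is the intersection of the preimages of the images of
`Spec ℤ[M i]` in `X` and of `Spec A` in `S`. -/
theorem range_chart (i : I) {A : CommRingCat.{u}} (t : Spec A ⟶ S) :
    Set.range (𝒜.chart i t) =
      (prod.fst : X ⨯ S ⟶ X) ⁻¹' Set.range (𝒜.ι i) ∩
        (prod.snd : X ⨯ S ⟶ S) ⁻¹' Set.range t := by
  have := isIso_prodLift_addMonoidAlgebra A (𝒜.monoid i)
  ext x
  constructor
  · rintro ⟨z, rfl⟩
    refine ⟨?_, z.comap (algebraMap A (AddMonoidAlgebra A (𝒜.monoid i))), (𝒜.snd_chart i t z).symm⟩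
    rw [Set.mem_preimage, ← Scheme.Hom.comp_apply, chart, Category.assoc, prod.map_fst,
      prod.lift_fst_assoc]
    exact ⟨_, rfl⟩
  · rintro ⟨⟨y, hy⟩, a, ha⟩
    obtain ⟨w, rfl⟩ := exists_prodMap_eq (𝒜.ι i) t x y a hy ha
    obtain ⟨z, rfl⟩ := (prod.lift
      (Spec.map (CommRingCat.ofHom (AddMonoidAlgebra.mapRingHom (𝒜.monoid i) (Int.castRingHom A))))
      (Spec.map (CommRingCat.ofHom
        (algebraMap A (AddMonoidAlgebra A (𝒜.monoid i)))))).surjective w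
    exact ⟨z, by rw [← Scheme.Hom.comp_apply]; rfl⟩

/-- The charts belonging to affine open subschemes `Spec A` of `S` cover `X ⨯ S`. -/
theorem exists_chart_eq (x : (X ⨯ S : Scheme.{u})) :
    ∃ (i : I) (A : CommRingCat.{u}) (t : Spec A ⟶ S) (_ : IsOpenImmersion t)
      (z : PrimeSpectrum (AddMonoidAlgebra A (𝒜.monoid i))), 𝒜.chart i t z = x := by
  obtain ⟨i, hi⟩ := 𝒜.exists_ι_eq ((prod.fst : X ⨯ S ⟶ X) x)
  let k := S.affineOpenCover.idx ((prod.snd : X ⨯ S ⟶ S) x)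
  obtain ⟨z, hz⟩ : x ∈ Set.range (𝒜.chart i (S.affineOpenCover.f k)) := by
    rw [range_chart]
    exact ⟨hi, S.affineOpenCover.covers _⟩
  exact ⟨i, _, S.affineOpenCover.f k, S.affineOpenCover.map_prop k, z, hz⟩

/-! ### The unit section -/

/-- The section of the projection `X ⨯ S ⟶ S` induced by the augmentation `ℤ[M i] ⟶ ℤ`. -/
noncomputable def unitSection (S : Scheme.{u}) (i : I) : S ⟶ X ⨯ S :=
  prod.lift (S.toSpecΓ ≫ Spec.map (CommRingCat.ofHom (AddMonoidAlgebra.liftNCRingHom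
    (Int.castRingHom Γ(S, ⊤)) (1 : Multiplicative (𝒜.monoid i) →* _) fun _ _ ↦ .all _ _)) ≫
      𝒜.ι i) (𝟙 S)

theorem unitSection_snd (i : I) : 𝒜.unitSection S i ≫ prod.snd = 𝟙 S :=
  prod.lift_snd _ _

theorem snd_unitSection (i : I) (s : S) :
    (prod.snd : X ⨯ S ⟶ S) (𝒜.unitSection S i s) = s :=
  congr($(𝒜.unitSection_snd i) s)

include 𝒜 in
theorem snd_surjective [Nonempty I] : Function.Surjective (prod.snd : X ⨯ S ⟶ S) := fun s ↦
  ⟨_, 𝒜.snd_unitSection (Classical.arbitrary I) s⟩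

include 𝒜 in
theorem isEmpty_prod [IsEmpty I] : IsEmpty (X ⨯ S : Scheme.{u}) :=
  ⟨fun x ↦ isEmptyElim (𝒜.exists_chart_eq x).choose⟩

/-! ### Irreducibility, connectedness, reducedness and normality of products -/

variable (ht : ∀ i, IsAddTorsionFree (𝒜.monoid i)) (hc : ∀ i, IsCancelAdd (𝒜.monoid i))

include ht hc in
theorem isOpenMap_snd : IsOpenMap (prod.snd : X ⨯ S ⟶ S) := by
  refine fun W hW ↦ isOpen_iff_forall_mem_open.mpr ?_
  rintro _ ⟨x, hx, rfl⟩
  obtain ⟨i, A, t, _, z, rfl⟩ := 𝒜.exists_chart_eq x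
  have := ht i
  have := hc i
  refine ⟨t '' (PrimeSpectrum.comap (algebraMap A (AddMonoidAlgebra A (𝒜.monoid i))) ''
    (𝒜.chart i t ⁻¹' W)), ?_, ?_, ?_⟩
  · rintro _ ⟨_, ⟨y, hy, rfl⟩, rfl⟩
    exact ⟨_, hy, 𝒜.snd_chart i t y⟩
  · exact t.isOpenEmbedding.isOpenMap _ (AddMonoidAlgebra.isOpenMap_comap_algebraMap _ _ _
      (hW.preimage (𝒜.chart i t).continuous))
  · exact ⟨_, ⟨z, hx, rfl⟩, (𝒜.snd_chart i t z).symm⟩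

include ht hc in
theorem irreducibleSpace_prod_spec_field [Nonempty I] (K : Type u) [Field K] :
    IrreducibleSpace (X ⨯ Spec (.of K) : Scheme.{u}) := by
  have hmem (i : I) : Set.range (𝒜.chart i (𝟙 (Spec (.of K)))) =
      (prod.fst : X ⨯ Spec (.of K) ⟶ X) ⁻¹' Set.range (𝒜.ι i) := by
    rw [range_chart]
    refine Set.inter_eq_left.mpr fun x _ ↦ ⟨_, rfl⟩
  have hirr (i : I) : IsIrreducible (Set.range (𝒜.chart i (𝟙 (Spec (.of K))))) := by
    have := ht i
    have := hc i
    have := AddMonoidAlgebra.isDomain_of_isAddTorsionFree K (𝒜.monoid i)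
    rw [← Set.image_univ]
    exact (PrimeSpectrum.irreducibleSpace.isIrreducible_univ
      (X := PrimeSpectrum (AddMonoidAlgebra K (𝒜.monoid i)))).image _
      (𝒜.chart i _).continuous.continuousOn
  refine irreducibleSpace_of_isOpen_of_inter_nonempty
    (fun i ↦ Set.range (𝒜.chart i (𝟙 (Spec (.of K)))))
    (fun i ↦ (𝒜.chart i _).isOpenEmbedding.isOpen_range) hirr (fun i j ↦ ?_) fun x ↦ ?_
  · obtain ⟨k, hki, hkj⟩ := 𝒜.exists_range_subset i j
    refine (hirr k).nonempty.mono ?_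
    simp only [hmem]
    exact Set.subset_inter (Set.preimage_mono hki) (Set.preimage_mono hkj)
  · obtain ⟨i, hi⟩ := 𝒜.exists_ι_eq ((prod.fst : X ⨯ Spec (.of K) ⟶ _) x)
    exact ⟨i, (hmem i).ge hi⟩

include ht hc in
theorem geometricallyIrreducible_snd [Nonempty I] :
    GeometricallyIrreducible (prod.snd : X ⨯ S ⟶ S) := by
  rw [geometricallyIrreducible_iff]
  introv K h
  have := 𝒜.irreducibleSpace_prod_spec_field ht hc K
  rwa [(h.isoIsPullback _ _ (isPullback_prodMap_id_left X y)).hom.homeomorph.irreducibleSpace_iff]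

include ht hc in
theorem irreducibleSpace_prod [Nonempty I] [IrreducibleSpace S] :
    IrreducibleSpace (X ⨯ S : Scheme.{u}) :=
  have := 𝒜.geometricallyIrreducible_snd (S := S) ht hc
  GeometricallyIrreducible.irreducibleSpace prod.snd (𝒜.isOpenMap_snd ht hc)

include ht hc in
theorem preconnectedSpace_prod [PreconnectedSpace S] :
    PreconnectedSpace (X ⨯ S : Scheme.{u}) := by
  cases isEmpty_or_nonempty I
  · have := 𝒜.isEmpty_prod (S := S)
    infer_instance
  cases isEmpty_or_nonempty S
  · have := Function.isEmpty (prod.snd : X ⨯ S ⟶ S)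
    infer_instance
  have : ConnectedSpace S := { toNonempty := inferInstance }
  have := 𝒜.geometricallyIrreducible_snd (S := S) ht hc
  have : GeometricallyConnected (prod.snd : X ⨯ S ⟶ S) := ⟨fun _ _ y _ f g h ↦
    have := GeometricallyIrreducible.geometrically_irreducibleSpace y f g h
    inferInstance⟩
  have := GeometricallyConnected.connectedSpace (prod.snd : X ⨯ S ⟶ S) (𝒜.isOpenMap_snd ht hc)
  infer_instance

include 𝒜 ht hc in
theorem isReduced_prod [IsIntegral S] : IsReduced (X ⨯ S : Scheme.{u}) := by
  have (x : (X ⨯ S : Scheme.{u})) : _root_.IsReduced ((X ⨯ S).presheaf.stalk x) := by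
    obtain ⟨i, A, t, _, z, rfl⟩ := 𝒜.exists_chart_eq x
    have := ht i
    have := hc i
    have : Nonempty (Spec A) := ⟨z.comap (algebraMap A _)⟩
    have : IsDomain A := (affine_isIntegral_iff A).mp (isIntegral_of_isOpenImmersion t)
    have := AddMonoidAlgebra.isDomain_of_isAddTorsionFree A (𝒜.monoid i)
    have e := stalkEquivLocalization (𝒜.chart i t) z
    exact isReduced_of_injective e e.injective
  exact isReduced_of_isReduced_stalk _

include ht in
theorem isNormalScheme_prod
    (hM : ∀ i, MonoidSystem.IsIntegrallyClosedMonoid (𝒜.monoid i))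
    (hS : MonoidSystem.IsNormalScheme S) : MonoidSystem.IsNormalScheme (X ⨯ S) := by
  intro x
  obtain ⟨i, A, t, _, z, rfl⟩ := 𝒜.exists_chart_eq x
  have := ht i
  let q := PrimeSpectrum.comap (algebraMap A (AddMonoidAlgebra A (𝒜.monoid i))) z
  -- The local ring of `S` at the image of `x` is the localization of `A` at the prime below `z`.
  have hq := (isDomain_and_isIntegrallyClosed_iff_of_ringEquiv (stalkEquivLocalization t q)).mp
    (hS (t q))
  exact (isDomain_and_isIntegrallyClosed_iff_of_ringEquiv
    (stalkEquivLocalization (𝒜.chart i t) z)).mpr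
      ((hM i).isIntegrallyClosed_localization z.asIdeal q.asIdeal rfl hq)

end MonoidAtlas

end AlgebraicGeometry

/-! ### The charts of `X_M(ℤ)` -/

namespace MonoidSystem

variable {I : Type u} [SemilatticeInf I]

/-- The canonical morphism `Spec ℤ[M i] ⟶ X_M(ℤ)` to the inductive limit. -/
noncomputable def chartι (M : Iᵒᵖ ⥤ AddCommMonCat.{u}) (hG : IsGluable M) (i : I) :
    Spec (.of (AddMonoidAlgebra ℤ (M.obj (.op i)))) ⟶ schemeInt M hG :=
  haveI := hG.hasColimit
  colimit.ι (charts M) i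

/-- The charts cover `X_M(ℤ)`: they factor through the union `U` of their images, so the universal
property of the colimit yields a section of the inclusion of `U`. -/
theorem exists_chartι_eq (M : Iᵒᵖ ⥤ AddCommMonCat.{u}) (hG : IsGluable M) (x : schemeInt M hG) :
    ∃ i y, chartι M hG i y = x := by
  have := hG.hasColimit
  have (i : I) : IsOpenImmersion (colimit.ι (charts M) i) := hG.isOpenImmersion_ι i
  let U : (colimit (charts M)).Opens := ⨆ i, (colimit.ι (charts M) i).opensRange
  have hU (i : I) : Set.range (colimit.ι (charts M) i) ⊆ Set.range U.ι := by
    rw [Scheme.Opens.range_ι]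
    exact le_iSup (fun i ↦ (colimit.ι (charts M) i).opensRange) i
  let c : Cocone (charts M) :=
    { pt := U
      ι :=
        { app i := IsOpenImmersion.lift U.ι (colimit.ι (charts M) i) (hU i)
          naturality i j f := by
            refine (cancel_mono U.ι).mp ?_
            refine (Category.assoc _ _ _).trans ?_
            refine (congrArg ((charts M).map f ≫ ·) (IsOpenImmersion.lift_fac _ _ _)).trans ?_
            refine (colimit.w (charts M) f).trans ?_
            refine .trans ?_ (Category.assoc _ _ _).symm
            refine (IsOpenImmersion.lift_fac U.ι _ (hU i)).symm.trans ?_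
            exact congrArg (IsOpenImmersion.lift U.ι _ (hU i) ≫ ·) (Category.id_comp U.ι).symm } }
  let r : colimit (charts M) ⟶ U := colimit.desc (charts M) c
  have hr : r ≫ U.ι = 𝟙 _ := colimit.hom_ext fun i ↦ by
    rw [Category.comp_id, colimit.ι_desc_assoc]
    exact IsOpenImmersion.lift_fac _ _ _
  have hx : U.ι (r x) = x := congr($hr x)
  have hx' : x ∈ U := by
    rw [← hx]
    exact (r x).2
  obtain ⟨i, hi⟩ := TopologicalSpace.Opens.mem_iSup.mp hx'
  exact ⟨i, hi⟩

theorem range_chartι_subset (M : Iᵒᵖ ⥤ AddCommMonCat.{u}) (hG : IsGluable M) {i j : I}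
    (h : i ≤ j) : Set.range (chartι M hG i) ⊆ Set.range (chartι M hG j) := by
  have := hG.hasColimit
  rintro _ ⟨y, rfl⟩
  refine ⟨(charts M).map (homOfLE h) y, ?_⟩
  exact congr($(colimit.w (charts M) (homOfLE h)) y)

/-- The charts `Spec ℤ[M i] ⟶ X_M(ℤ)` form an atlas, since the chart of `i ⊓ j` is contained in
those of `i` and `j`. -/
noncomputable def atlas (M : Iᵒᵖ ⥤ AddCommMonCat.{u}) (hG : IsGluable M) :
    MonoidAtlas I (schemeInt M hG) where
  monoid i := M.obj (.op i)
  ι := chartι M hG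
  isOpenImmersion_ι := hG.isOpenImmersion_ι
  exists_ι_eq := exists_chartι_eq M hG
  exists_range_subset i j := ⟨i ⊓ j, range_chartι_subset M hG inf_le_left,
    range_chartι_subset M hG inf_le_right⟩

end MonoidSystem

theorem propositionn220 {I : Type u} [SemilatticeInf I] (M : Iᵒᵖ ⥤ AddCommMonCat.{u})
    (hM : MonoidSystem.IsOpenlyImmersive M) (hG : MonoidSystem.IsGluable M) (S : Scheme.{u}) :
    -- a) connectedness (the empty space counts as connected)
    ((PreconnectedSpace (MonoidSystem.scheme M hG S) → PreconnectedSpace S ∨ IsEmpty I) ∧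
      (MonoidSystem.IsTorsionFree M → MonoidSystem.IsCancellable M →
        (Finite I ∨ MonoidSystem.IsOfFiniteType M ∨ (IsAffine S ∧ ∃ i₀ : I, ∀ i : I, i₀ ≤ i)) →
        (PreconnectedSpace S ∨ IsEmpty I) →
        PreconnectedSpace (MonoidSystem.scheme M hG S))) ∧
    -- b) irreducibility
    ((IrreducibleSpace (MonoidSystem.scheme M hG S) → IrreducibleSpace S ∧ Nonempty I) ∧
      (MonoidSystem.IsTorsionFree M → MonoidSystem.IsCancellable M →
        (IrreducibleSpace S ∧ Nonempty I) →
        IrreducibleSpace (MonoidSystem.scheme M hG S))) ∧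
    -- c) integrality
    ((AlgebraicGeometry.IsIntegral (MonoidSystem.scheme M hG S) → AlgebraicGeometry.IsIntegral S ∧ Nonempty I) ∧
      (MonoidSystem.IsTorsionFree M → MonoidSystem.IsCancellable M →
        (AlgebraicGeometry.IsIntegral S ∧ Nonempty I) →
        AlgebraicGeometry.IsIntegral (MonoidSystem.scheme M hG S))) ∧
    -- d) normality
    ((MonoidSystem.IsNormalScheme (MonoidSystem.scheme M hG S) →
        MonoidSystem.IsNormalScheme S ∨ IsEmpty I) ∧
      (MonoidSystem.IsTorsionFree M → MonoidSystem.IsIntegrallyClosedSystem M →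
        (MonoidSystem.IsNormalScheme S ∨ IsEmpty I) →
        MonoidSystem.IsNormalScheme (MonoidSystem.scheme M hG S))) := by
  let 𝒜 := MonoidSystem.atlas M hG
  rw [MonoidSystem.scheme]
  cases isEmpty_or_nonempty I with
  | inl hI =>
    have := 𝒜.isEmpty_prod (S := S)
    have hn : ¬ Nonempty (MonoidSystem.schemeInt M hG ⨯ S : Scheme.{u}) :=
      not_nonempty_iff.mpr this
    exact ⟨⟨fun _ ↦ .inr hI, fun _ _ _ _ ↦ inferInstance⟩,
      ⟨fun h ↦ (hn h.toNonempty).elim, fun _ _ h ↦ (not_nonempty_iff.mpr hI h.2).elim⟩,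
      ⟨fun h ↦ (hn h.nonempty).elim, fun _ _ h ↦ (not_nonempty_iff.mpr hI h.2).elim⟩,
      ⟨fun _ ↦ .inr hI, fun _ _ _ x ↦ isEmptyElim x⟩⟩
  | inr hI =>
    -- The section through which the properties descend from `X_M(S)` to `S`.
    let σ := 𝒜.unitSection S (Classical.arbitrary I)
    have hσ : σ ≫ prod.snd = 𝟙 S := 𝒜.unitSection_snd _
    have hsurj := 𝒜.snd_surjective (S := S)
    have hirr (h : IrreducibleSpace (MonoidSystem.schemeInt M hG ⨯ S : Scheme.{u})) :
        IrreducibleSpace S := by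
      have := (h.isIrreducible_univ).image _ (prod.snd : _ ⨯ S ⟶ S).continuous.continuousOn
      rw [Set.image_univ, hsurj.range_eq] at this
      exact irreducibleSpace_def S |>.mpr this
    refine ⟨⟨fun h ↦ .inl (hsurj.denseRange.preconnectedSpace (prod.snd : _ ⨯ S ⟶ S).continuous),
      fun ht hc _ h ↦ ?_⟩, ⟨fun h ↦ ⟨hirr h, hI⟩, fun ht hc h ↦ ?_⟩,
      ⟨fun h ↦ ⟨?_, hI⟩, fun ht hc h ↦ ?_⟩, ⟨fun h ↦ .inl fun s ↦ ?_, fun ht hc h ↦ ?_⟩⟩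
    · have := h.resolve_right (not_isEmpty_of_nonempty I)
      exact 𝒜.preconnectedSpace_prod ht hc
    · have := h.1
      exact 𝒜.irreducibleSpace_prod ht hc
    · have := hirr inferInstance
      have := isReduced_of_section hσ
      exact isIntegral_of_irreducibleSpace_of_isReduced S
    · have := h.1
      have := 𝒜.irreducibleSpace_prod (S := S) ht hc
      have := 𝒜.isReduced_prod (S := S) ht hc
      exact isIntegral_of_irreducibleSpace_of_isReduced _
    · obtain ⟨_, _⟩ := h (σ s)
      obtain ⟨f, hf⟩ := exists_stalkMap_comp_eq_id hσ s
      exact isDomain_and_isIntegrallyClosed_of_comp_eq_id f _ hf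
    · exact 𝒜.isNormalScheme_prod ht hc (h.resolve_right (not_isEmpty_of_nonempty I))
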